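/- Conventions. A poset is a partially ordered set with a least element $\bot$; it is complete if each directed (non-empty) subset has a least upper bound, and algebraic if moreover for each $x$ the set of compact elements below $x$ is directed with least upper bound $x$. A map between complete posets is continuous if it is monotone and preserves least upper bounds of directed sets, and bottomed if it sends $\bot$ to $\bot$. A completion of a poset $Y$ is a complete poset $X$ containing $Y$ as a subposet (with the same order and the same $\bot$) such that each element of $X$ is the least upper bound of a directed subset of $Y$; it is initial if for each completion $X'$ of $Y$ there is a unique continuous map $X\to X'$ fixing $Y$ pointwise. Let $\Lambda=(B,K,\Theta)$ be a signature: a set $B$ of types and a set $K$ of operator names, each $k\in K$ having a finite family of argument types $(b_\eta)_{\eta\in I_k}$ in $B$ and a result type $b_k\in B$. Put $K_b=\{k : b_k=b\}$ and $A=\{b\in B: K_b=\varnothing\}$ (the parameters). An ordered (resp. continuous) $\Lambda$-algebra $(X,p)$ consists of posets (resp. complete posets) $X_b$, $b\in B$, and monotone (resp. continuous) maps $p_k:\prod_{\eta}X_{b_\eta}\to X_{b_k}$, $k\in K$. Its homomorphisms are families $\pi_b:X_b\to X'_b$ of bottomed monotone maps commuting with the operators; a continuous homomorphism is one all of whose components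 are continuous. The algebra is bound to a family $V=(V_a)_{a\in A}$ if $X_a=V_a$ for $a\in A$. It is intrinsic if for each $b\in B\setminus A$ each $x\ne\bot$ in $X_b$ is $p_k(v)$ for a unique $k\in K_b$ and a unique $v$, and for $x_1,x_2\ne\bot$ in $X_b$ one has $x_1\sqsubseteq x_2$ if and only if $x_1=p_k(v_1)$, $x_2=p_k(v_2)$ for some $k\in K_b$ and $v_1\sqsubseteq v_2$. An algebra bound to $U$ is $U$-minimal if the only family of subsets $S_b\subset X_b$ that is closed under the operators, contains all the $\bot_b$ and satisfies $S_a=U_a$ for $a\in A$ is $S=X$. A simple head type $\diamond$ is a family of maps $\diamond_k:\{\bot,\natural\}^{I_k}\to\{\bot,\natural\}$, $k\in K$. It is $\natural$-stable if whenever $\diamond_k(v_1)=\natural$ and $v_2(\eta)=\natural$ for all $\eta$ with $v_1(\eta)=\natural$, then $\diamond_k(v_2)=\natural$. An ordered algebra is a $\diamond$-algebra if the maps sending $\bot_b$ to $\bot$ and all other elements of $X_b$ to $\natural$ commute with the operators. Proposition. Let $\diamond$ be a $\natural$-stable simple head type and let $V=(V_a)_{a\in A}$ be a family of algebraic posets.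 For $a\in A$ let $U_a$ be the subposet of compact elements of $V_a$. There exists a $U$-minimal intrinsic ordered $\diamond$-algebra $(Y,q)$. Let $(Y,q)$ be any such algebra. Then it has an initial completion $(X,p)$ with $X_a=V_a$ for all $a\in A$, i.e. a continuous $\Lambda$-algebra such that $X_b$ is an initial completion of $Y_b$ for each $b\in B$ (on the parameters via the inclusion $U_a\subset V_a$) and $p_k$ extends $q_k$ for each $k\in K$. Any such $(X,p)$ is a continuous $\diamond$-algebra bound to $V$, and: (1) $(X,p)$ is an initial object in the category of continuous $\diamond$-algebras bound to $V$: for each continuous $\diamond$-algebra $(X',p')$ bound to $V$ there is a unique continuous homomorphism $\pi:(X,p)\to(X',p')$ with $\pi_a=\mathrm{id}_{V_a}$ for all $a\in A$. (2) $(X,p)$ is intrinsically free: for each continuous $\diamond$-algebra $(X',p')$ and each family of bottomed continuous maps $\tau_a:V_a\to X'_a$, $a\in A$, there is a unique continuous homomorphism $\pi:(X,p)\to(X',p')$ with $\pi_a=\tau_a$ for all $a\in A$. -/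

import Mathlib

universe u v w

namespace DataAlg

/-! ### Posets, completions, algebraic posets

A *poset* always has a least element: it is a type with `[PartialOrder X] [OrderBot X]`.
Directed sets are non-empty. Continuity of a map between complete posets is Mathlib's
`ScottContinuous`, compactness of an element is Mathlib's `IsCompactElement`. -/

section Posets

/-- Every directed (non-empty) subset has a least upper bound. -/
def IsCompletePoset (X : Type u) [PartialOrder X] : Prop :=
  ∀ D : Set X, D.Nonempty → DirectedOn (· ≤ ·) D → ∃ x, IsLUB D x

/-- A complete poset in which, for every `x`, the set of compact elements below `x` is directed
with least upper bound `x`. -/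
def IsAlgebraicPoset (X : Type u) [PartialOrder X] : Prop :=
  IsCompletePoset X ∧
    ∀ x : X, {y : X | IsCompactElement y ∧ y ≤ x}.Nonempty ∧
      DirectedOn (· ≤ ·) {y : X | IsCompactElement y ∧ y ≤ x} ∧
      IsLUB {y : X | IsCompactElement y ∧ y ≤ x} x

/-- The compact elements of `X`, ordered as a subset of `X`. -/
abbrev Compacts (X : Type u) [PartialOrder X] : Type u :=
  {x : X // IsCompactElement x}

/-- `X`, together with the embedding `i : Y → X` that exhibits `Y` as a subposet of `X` (same order,
same bottom element), is a completion of `Y`: the poset `X` is complete and every element of `X` is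
the least upper bound in `X` of some directed subset of `Y`. -/
structure IsCompletion {Y : Type u} {X : Type v} [PartialOrder Y] [OrderBot Y]
    [PartialOrder X] [OrderBot X] (i : Y → X) : Prop where
  le_iff : ∀ y y' : Y, i y ≤ i y' ↔ y ≤ y'
  map_bot : i ⊥ = ⊥
  complete : IsCompletePoset X
  exists_directed : ∀ x : X, ∃ D : Set Y, D.Nonempty ∧ DirectedOn (· ≤ ·) D ∧ IsLUB (i '' D) x

/-- An initial (ideal) completion of `Y`: an initial object in the category whose objects are
completions of `Y` and whose morphisms are the continuous maps that fix `Y` pointwise. -/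
structure IsInitialCompletion {Y X : Type u} [PartialOrder Y] [OrderBot Y]
    [PartialOrder X] [OrderBot X] (i : Y → X) : Prop where
  isCompletion : IsCompletion i
  initial : ∀ (X' : Type u) [PartialOrder X'] [OrderBot X'] (i' : Y → X'), IsCompletion i' →
    ∃! h : X → X', ScottContinuous h ∧ ∀ y, h (i y) = i' y

end Posets

/-! ### Signatures and bottomed algebras -/

/-- A signature `(B, K, Θ)`: `B` is the set of types; the set `K` of operator names is given through
its partition into the sets `K b = {k | the codomain of k is b}`; the domain of `k` is a finite
`B`-typing `dom k : Arity k → B`. -/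
structure Signature where
  B : Type u
  K : B → Type u
  Arity : {b : B} → K b → Type u
  finite_arity : ∀ {b : B} (k : K b), Finite (Arity k)
  dom : {b : B} → (k : K b) → Arity k → B

namespace Signature

/-- The parameter set `A = {b ∈ B | K b = ∅}`. -/
abbrev Param (Λ : Signature.{u}) : Type u := {b : Λ.B // IsEmpty (Λ.K b)}

/-- The product over the arguments of `k` of a `B`-family `X`: the domain of the operator `k`. -/
abbrev Args (Λ : Signature.{u}) (X : Λ.B → Type v) {b : Λ.B} (k : Λ.K b) : Type (max u v) :=
  ∀ η : Λ.Arity k, X (Λ.dom k η)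

end Signature

/-- A bottomed `Λ`-algebra. -/
structure BottomedAlgebra (Λ : Signature.{u}) where
  carrier : Λ.B → Type v
  bot : ∀ b, carrier b
  op : ∀ {b : Λ.B} (k : Λ.K b), Λ.Args carrier k → carrier b

namespace BottomedAlgebra

variable {Λ : Signature.{u}}

/-- Bottomed homomorphisms. -/
structure IsBottomedHom (X : BottomedAlgebra.{u, v} Λ) (Y : BottomedAlgebra.{u, w} Λ)
    (π : ∀ b, X.carrier b → Y.carrier b) : Prop where
  map_op : ∀ {b : Λ.B} (k : Λ.K b) (x : Λ.Args X.carrier k),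
    π b (X.op k x) = Y.op k (fun η => π _ (x η))
  map_bot : ∀ b, π b (X.bot b) = Y.bot b

/-- A family of maps is proper if it sends non-bottom elements to non-bottom elements. -/
def IsProper (X : BottomedAlgebra.{u, v} Λ) (Y : BottomedAlgebra.{u, w} Λ)
    (π : ∀ b, X.carrier b → Y.carrier b) : Prop :=
  ∀ b (x : X.carrier b), x ≠ X.bot b → π b x ≠ Y.bot b

/-- `X` is an algebra associated with `H`: there is a proper bottomed homomorphism `X → H`. -/
def IsAssociatedWith (X : BottomedAlgebra.{u, v} Λ) (H : BottomedAlgebra.{u, w} Λ) : Prop :=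
  ∃ π : ∀ b, X.carrier b → H.carrier b, IsBottomedHom X H π ∧ IsProper X H π

/-- Being `♮`-stable: if `p_k(v₁) ≠ ⊥` and `v₂` is non-bottom at every argument at which `v₁` is
non-bottom, then `p_k(v₂) ≠ ⊥`. -/
def IsStable (X : BottomedAlgebra.{u, v} Λ) : Prop :=
  ∀ {b : Λ.B} (k : Λ.K b) (v₁ v₂ : Λ.Args X.carrier k),
    X.op k v₁ ≠ X.bot b →
    (∀ η, v₁ η ≠ X.bot _ → v₂ η ≠ X.bot _) →
    X.op k v₂ ≠ X.bot b

/-- Regularity: if `b` is not a parameter, every non-bottom element of `X_b` is `p_k(v)` for a unique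
`k ∈ K_b` and a unique `v`. -/
def IsRegular (X : BottomedAlgebra.{u, v} Λ) : Prop :=
  ∀ b : Λ.B, Nonempty (Λ.K b) → ∀ x : X.carrier b, x ≠ X.bot b →
    ∃! kv : (Σ k : Λ.K b, Λ.Args X.carrier k), X.op kv.1 kv.2 = x

/-- A family `S` of subsets of an algebra is invariant if it is closed under the operators. -/
def IsInvariant (X : BottomedAlgebra.{u, v} Λ) (S : ∀ b, Set (X.carrier b)) : Prop :=
  ∀ {b : Λ.B} (k : Λ.K b) (x : Λ.Args X.carrier k), (∀ η, x η ∈ S _) → X.op k x ∈ S b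

/-- Minimality of `X` with respect to its own parameter sets: the whole of `X` is the only invariant
family of subsets that contains all the bottom elements and is everything on the parameters. -/
def IsMinimal (X : BottomedAlgebra.{u, v} Λ) : Prop :=
  ∀ S : ∀ b, Set (X.carrier b), X.IsInvariant S → (∀ b, X.bot b ∈ S b) →
    (∀ a : Λ.Param, S a = Set.univ) → ∀ b, S b = Set.univ

end BottomedAlgebra

/-! ### Simple head types -/

/-- The two-element bottomed set `𝕋 = {⊥, ♮}`. -/
inductive Head : Type
  | bot : Head
  | nat : Head

/-- A simple head type: a bottomed algebra all of whose carriers are `𝕋`; only its operators have to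
be specified. -/
structure SimpleHeadType (Λ : Signature.{u}) where
  op : ∀ {b : Λ.B} (k : Λ.K b), (Λ.Arity k → Head) → Head

/-- A simple head type as a bottomed algebra. -/
def SimpleHeadType.toBottomed {Λ : Signature.{u}} (d : SimpleHeadType Λ) :
    BottomedAlgebra.{u, 0} Λ where
  carrier := fun _ => Head
  bot := fun _ => Head.bot
  op := fun k v => d.op k v

/-! ### Ordered and continuous algebras -/

/-- An ordered `Λ`-algebra: a family of posets with monotone operators (products carry the
componentwise order). -/
structure OrderedAlgebra (Λ : Signature.{u}) where
  carrier : Λ.B → Type u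
  [partialOrder : ∀ b, PartialOrder (carrier b)]
  [orderBot : ∀ b, OrderBot (carrier b)]
  op : ∀ {b : Λ.B} (k : Λ.K b), Λ.Args carrier k → carrier b
  monotone_op : ∀ {b : Λ.B} (k : Λ.K b), Monotone (op k)

attribute [instance] OrderedAlgebra.partialOrder OrderedAlgebra.orderBot

namespace OrderedAlgebra

variable {Λ : Signature.{u}}

/-- The underlying bottomed algebra. -/
def toBottomed (X : OrderedAlgebra Λ) : BottomedAlgebra.{u, u} Λ where
  carrier := X.carrier
  bot := fun _ => ⊥
  op := fun k v => X.op k v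

/-- A `⋄`-algebra, for a simple head type `⋄`. -/
def IsHeadAlgebra (X : OrderedAlgebra Λ) (d : SimpleHeadType Λ) : Prop :=
  X.toBottomed.IsAssociatedWith d.toBottomed

/-- An intrinsic ordered algebra. -/
structure IsIntrinsic (X : OrderedAlgebra Λ) : Prop where
  regular : X.toBottomed.IsRegular
  le_iff : ∀ b : Λ.B, Nonempty (Λ.K b) → ∀ x₁ x₂ : X.carrier b, x₁ ≠ ⊥ → x₂ ≠ ⊥ →
    (x₁ ≤ x₂ ↔ ∃ (k : Λ.K b) (v₁ v₂ : Λ.Args X.carrier k),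
      x₁ = X.op k v₁ ∧ x₂ = X.op k v₂ ∧ v₁ ≤ v₂)

/-- A continuous algebra: the carriers are complete posets and the operators are continuous. -/
structure IsContinuous (X : OrderedAlgebra Λ) : Prop where
  complete : ∀ b, IsCompletePoset (X.carrier b)
  continuous_op : ∀ {b : Λ.B} (k : Λ.K b), ScottContinuous (X.op k)

/-- Continuous homomorphisms: bottomed homomorphisms that are monotone and continuous. -/
structure IsContinuousHom (X Y : OrderedAlgebra Λ) (π : ∀ b, X.carrier b → Y.carrier b) :
    Prop where
  isBottomedHom : BottomedAlgebra.IsBottomedHom X.toBottomed Y.toBottomed π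
  monotone : ∀ b, Monotone (π b)
  continuous : ∀ b, ScottContinuous (π b)

/-- `X` is bound to the family `V` of posets indexed by the parameters: an identification, for each
parameter `a`, of the poset `V a` with the poset `X_a`. -/
abbrev Binding (X : OrderedAlgebra Λ) (V : Λ.Param → Type u) [∀ a, PartialOrder (V a)] : Type u :=
  ∀ a : Λ.Param, V a ≃o X.carrier a

/-- The algebra `X`, with the family of embeddings `i : Y → X`, is an initial completion of the
ordered algebra `Y`: it is a continuous algebra, each `X_b` is an initial completion of `Y_b`, and
each operator of `X` extends the corresponding operator of `Y`. -/
structure IsInitialCompletionOf (X Y : OrderedAlgebra Λ)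
    (i : ∀ b, Y.carrier b → X.carrier b) : Prop where
  isContinuous : X.IsContinuous
  isInitialCompletion : ∀ b, IsInitialCompletion (i b)
  op_extends : ∀ {b : Λ.B} (k : Λ.K b) (v : Λ.Args Y.carrier k),
    X.op k (fun η => i _ (v η)) = i b (Y.op k v)

/-- `Y`, bound to `U` through `ι`, is a `U`-minimal intrinsic ordered `⋄`-algebra. -/
structure IsMinimalIntrinsicHeadAlgebra (Y : OrderedAlgebra Λ) (d : SimpleHeadType Λ)
    {U : Λ.Param → Type u} [∀ a, PartialOrder (U a)] (_ι : Y.Binding U) : Prop where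
  minimal : Y.toBottomed.IsMinimal
  intrinsic : Y.IsIntrinsic
  isHeadAlgebra : Y.IsHeadAlgebra d

/-- `X` is an initial completion of `Y` with `X_a = V_a` for each parameter `a`, where `Y` is bound to
the subposets of compact elements of the `V_a`: on the parameters the embedding `i : Y → X` is the
inclusion of the compact elements of `V_a` in `V_a`. -/
structure IsInitialCompletionOver (V : Λ.Param → Type u) [∀ a, PartialOrder (V a)]
    (Y : OrderedAlgebra Λ) (ιY : Y.Binding (fun a => Compacts (V a)))
    (X : OrderedAlgebra Λ) (ιX : X.Binding V)
    (i : ∀ b, Y.carrier b → X.carrier b) : Prop where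
  isInitialCompletionOf : X.IsInitialCompletionOf Y i
  compatible : ∀ (a : Λ.Param) (x : Compacts (V a)), i a (ιY a x) = ιX a x.1

/-- `X`, bound to `V` through `ι`, is an initial object in the full subcategory of continuous
`⋄`-algebras bound to `V`; the morphisms are the continuous homomorphisms that fix `V`. -/
structure IsInitialBound (d : SimpleHeadType Λ) (V : Λ.Param → Type u) [∀ a, PartialOrder (V a)]
    (X : OrderedAlgebra Λ) (ι : X.Binding V) : Prop where
  isContinuous : X.IsContinuous
  isHeadAlgebra : X.IsHeadAlgebra d
  existsUnique_hom : ∀ (X' : OrderedAlgebra Λ) (ι' : X'.Binding V),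
    X'.IsContinuous → X'.IsHeadAlgebra d →
    ∃! π : ∀ b, X.carrier b → X'.carrier b,
      IsContinuousHom X X' π ∧ ∀ (a : Λ.Param) (x : V a), π a (ι a x) = ι' a x

/-- `X`, bound to `V` through `ι`, is intrinsically free among the continuous `⋄`-algebras. -/
def IsIntrinsicallyFree (d : SimpleHeadType Λ) (V : Λ.Param → Type u) [∀ a, PartialOrder (V a)]
    [∀ a, OrderBot (V a)] (X : OrderedAlgebra Λ) (ι : X.Binding V) : Prop :=
  ∀ X' : OrderedAlgebra Λ, X'.IsContinuous → X'.IsHeadAlgebra d →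
    ∀ τ : ∀ a : Λ.Param, V a → X'.carrier a,
      (∀ a, τ a ⊥ = ⊥) → (∀ a, ScottContinuous (τ a)) →
      ∃! π : ∀ b, X.carrier b → X'.carrier b,
        IsContinuousHom X X' π ∧ ∀ (a : Λ.Param) (x : V a), π a (ι a x) = τ a x

end OrderedAlgebra

end DataAlg

open DataAlg OrderedAlgebra

/-!
The initial completion of a poset `Y` is its poset of ideals, and a monotone map from `Y` into a
complete poset extends continuously by `I ↦ sup f(I)`. Initiality among completions alone concerns
only maps into completions of `Y`; but it provides a continuous map from any initial completion to
the ideal completion, and hence extensions of arbitrary monotone maps into complete posets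
(`IsInitialCompletion.exists_extension`). Continuous maps are determined by their values on `Y`,
also in several variables (`IsCompletion.ext`, `IsCompletion.ext_pi`).

Applying this type by type to an ordered algebra gives its initial completion; the extended
operators are continuous because they have finitely many arguments (`scottContinuous_idealMap`),
and on the parameters an algebraic poset is the ideal completion of its compact elements
(`IsAlgebraicPoset.orderIsoIdeal`). The completion keeps a `♮`-stable head type
(`OrderedAlgebra.IsInitialCompletionOf.isHeadAlgebra`).

Let `(Y, q)` be a minimal intrinsic `⋄`-algebra. Bottomed monotone maps given on its parameters
extend to a homomorphism `π` into any `⋄`-algebra `(Z, p)`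
(`exists_hom_of_minimal_intrinsic`): minimality makes the recursion `π(q_k(v)) = p_k(π(v))` total
and its solution unique, the intrinsic order makes it single-valued and monotone, and stability of
`⋄` forces `p_k(π(v)) = ⊥` whenever `q_k(v) = ⊥`, although `π` may send non-bottom elements to `⊥`.
Extending `π` continuously to the completion yields freeness
(`isIntrinsicallyFree_of_isInitialCompletionOver`), of which initiality among the algebras bound to
`V` is the case where the given maps identify the parameters.

A minimal intrinsic `⋄`-algebra is obtained from the formal terms in which no operator is to be
evaluated to `⊥` (`FormalTerm.reducedAlgebra`); its operators are monotone by stability.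
-/

namespace DataAlg

/-! ### Scott-continuous maps out of completions -/

section Completions

theorem scottContinuous_orderIso {X : Type*} {Y : Type*} [PartialOrder X] [PartialOrder Y]
    (e : X ≃o Y) : ScottContinuous e := by
  intro D _ _ a ha
  exact e.isLUB_image'.2 ha

theorem scottContinuous_pi_map {J : Type*} {X : J → Type*} {Z : J → Type*}
    [∀ j, PartialOrder (X j)] [∀ j, PartialOrder (Z j)] {F : ∀ j, X j → Z j}
    (hF : ∀ j, ScottContinuous (F j)) :
    ScottContinuous (fun (x : ∀ j, X j) j => F j (x j)) := by
  intro D hD hdir x hx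
  rw [isLUB_pi] at hx ⊢
  intro j
  have := hF j (hD.image _) (hdir.mono_comp (g := Function.eval j) (fun _ _ h => h j)) (hx j)
  rwa [Set.image_image] at this ⊢

variable {Y : Type u} {X : Type v} [PartialOrder Y] [OrderBot Y] [PartialOrder X] [OrderBot X]
  {i : Y → X}

theorem IsCompletion.monotone (hi : IsCompletion i) : Monotone i :=
  fun _ _ h => (hi.le_iff _ _).2 h

/-- A non-bottom element of a completion of `Y` lies above a non-bottom element of `Y`. -/
theorem IsCompletion.exists_ne_bot_le (hi : IsCompletion i) {x : X} (hx : x ≠ ⊥) :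
    ∃ y, y ≠ ⊥ ∧ i y ≤ x := by
  obtain ⟨D, -, -, hD⟩ := hi.exists_directed x
  by_contra! h
  refine hx (le_bot_iff.1 (hD.2 ?_))
  rintro _ ⟨y, hy, rfl⟩
  by_contra hne
  refine h y ?_ (hD.1 ⟨y, hy, rfl⟩)
  rintro rfl
  exact hne hi.map_bot.le

/-- Every tuple in a product of completions is the least upper bound of a directed set of tuples
of elements of the completed posets. -/
theorem IsCompletion.exists_directed_pi {J : Type*} {Y : J → Type*} {X : J → Type*}
    [∀ j, PartialOrder (Y j)] [∀ j, OrderBot (Y j)] [∀ j, PartialOrder (X j)]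
    [∀ j, OrderBot (X j)] {i : ∀ j, Y j → X j} (hi : ∀ j, IsCompletion (i j)) (x : ∀ j, X j) :
    ∃ D : Set (∀ j, Y j), D.Nonempty ∧ DirectedOn (· ≤ ·) D ∧
      IsLUB ((fun v j => i j (v j)) '' D) x := by
  classical
  choose D hne hdir hlub using fun j => (hi j).exists_directed (x j)
  choose y hy using hne
  refine ⟨{v : ∀ j, Y j | ∀ j, v j ∈ D j}, ⟨y, hy⟩, ?_, ?_⟩
  · intro v hv w hw
    choose z hz hvz hwz using fun j => hdir j (v j) (hv j) (w j) (hw j)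
    exact ⟨z, hz, hvz, hwz⟩
  · rw [isLUB_pi]
    intro j
    have : Function.eval j '' ((fun (v : ∀ j, Y j) j => i j (v j)) '' {v | ∀ j, v j ∈ D j}) =
        i j '' D j := by
      ext t
      constructor
      · rintro ⟨_, ⟨v, hv, rfl⟩, rfl⟩
        exact ⟨v j, hv j, rfl⟩
      · rintro ⟨s, hs, rfl⟩
        refine ⟨_, ⟨Function.update y j s, fun j' => ?_, rfl⟩, by simp⟩
        by_cases h : j' = j
        · subst h; simpa using hs
        · simpa [h] using hy j'
    rw [this]
    exact hlub j

/-- Continuous maps on a product of completions are determined by their values on tuples of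
elements of the completed posets. -/
theorem IsCompletion.ext_pi {J : Type*} {Y : J → Type*} {X : J → Type*} {Z : Type*}
    [∀ j, PartialOrder (Y j)] [∀ j, OrderBot (Y j)] [∀ j, PartialOrder (X j)]
    [∀ j, OrderBot (X j)] [PartialOrder Z] {i : ∀ j, Y j → X j} (hi : ∀ j, IsCompletion (i j))
    {f g : (∀ j, X j) → Z} (hf : ScottContinuous f) (hg : ScottContinuous g)
    (h : ∀ v : ∀ j, Y j, f (fun j => i j (v j)) = g (fun j => i j (v j))) : f = g := by
  funext x
  obtain ⟨D, hne, hdir, hx⟩ := exists_directed_pi hi x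
  have hdir' := hdir.mono_comp (rb := (· ≤ ·)) (g := fun (v : ∀ j, Y j) j => i j (v j))
    (fun _ _ h j => (hi j).monotone (h j))
  have h1 := hf (hne.image _) hdir' hx
  have h2 := hg (hne.image _) hdir' hx
  rw [Set.image_image] at h1 h2
  simp only [h] at h1
  exact h1.unique h2

/-- Continuous maps on a completion of `Y` are determined by their values on `Y`. -/
theorem IsCompletion.ext {Z : Type*} [PartialOrder Z] (hi : IsCompletion i) {f g : X → Z}
    (hf : ScottContinuous f) (hg : ScottContinuous g) (h : ∀ y, f (i y) = g (i y)) : f = g := by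
  funext x
  obtain ⟨D, hne, hdir, hx⟩ := hi.exists_directed x
  have hdir' := hdir.mono_comp (g := i) (fun _ _ h => hi.monotone h)
  have h1 := hf (hne.image _) hdir' hx
  have h2 := hg (hne.image _) hdir' hx
  rw [Set.image_image] at h1 h2
  simp only [h] at h1
  exact h1.unique h2

end Completions

/-! ### The ideal completion -/

section Ideals

open Order

variable {Y : Type u} [PartialOrder Y]

/-- The union of a non-empty directed set of ideals. -/
def idealUnion (D : Set (Ideal Y)) (hne : D.Nonempty) (hdir : DirectedOn (· ≤ ·) D) : Ideal Y where
  carrier := {y | ∃ I ∈ D, y ∈ I}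
  lower' := fun _ _ h ⟨I, hI, hy⟩ => ⟨I, hI, I.lower h hy⟩
  nonempty' := by
    obtain ⟨I, hI⟩ := hne
    obtain ⟨y, hy⟩ := I.nonempty
    exact ⟨y, I, hI, hy⟩
  directed' := by
    rintro x ⟨I, hI, hx⟩ y ⟨J, hJ, hy⟩
    obtain ⟨L, hL, hIL, hJL⟩ := hdir I hI J hJ
    obtain ⟨z, hz, hxz, hyz⟩ := L.directed x (hIL hx) y (hJL hy)
    exact ⟨z, ⟨L, hL, hz⟩, hxz, hyz⟩

theorem isLUB_idealUnion (D : Set (Ideal Y)) (hne : D.Nonempty) (hdir : DirectedOn (· ≤ ·) D) :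
    IsLUB D (idealUnion D hne hdir) :=
  ⟨fun I hI _ hy => ⟨I, hI, hy⟩, fun _ hJ _ ⟨_, hI, hy⟩ => hJ hI hy⟩

theorem isCompletePoset_ideal : IsCompletePoset (Ideal Y) :=
  fun D hne hdir => ⟨_, isLUB_idealUnion D hne hdir⟩

theorem mem_iff_of_isLUB_ideal {D : Set (Ideal Y)} (hne : D.Nonempty)
    (hdir : DirectedOn (· ≤ ·) D) {J : Ideal Y} (hJ : IsLUB D J) {y : Y} :
    y ∈ J ↔ ∃ I ∈ D, y ∈ I := by
  rw [hJ.unique (isLUB_idealUnion D hne hdir)]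
  rfl

/-- The ideal completion: principal ideals exhibit `Y` as a subposet of its poset of ideals. -/
theorem isCompletion_principal [OrderBot Y] :
    IsCompletion (Ideal.principal : Y → Ideal Y) where
  le_iff _ _ := by simp
  map_bot := rfl
  complete := isCompletePoset_ideal
  exists_directed I := ⟨I, I.nonempty, I.directed,
    by rintro _ ⟨y, hy, rfl⟩; exact Ideal.principal_le_iff.2 hy,
    fun _ hJ y hy => Ideal.principal_le_iff.1 (hJ ⟨y, hy, rfl⟩)⟩

/-- A monotone map into a complete poset extends continuously to the ideal completion, by
`I ↦ sup f(I)`. -/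
theorem exists_extension_ideal {Z : Type*} [PartialOrder Z]
    (hZ : IsCompletePoset Z) {f : Y → Z} (hf : Monotone f) :
    ∃ F : Ideal Y → Z, ScottContinuous F ∧ ∀ y, F (Ideal.principal y) = f y := by
  have hdir (I : Ideal Y) : DirectedOn (· ≤ ·) (f '' I) :=
    I.directed.mono_comp (fun _ _ h => hf h)
  choose F hF using fun I : Ideal Y => hZ (f '' I) (I.nonempty.image f) (hdir I)
  refine ⟨F, fun D hne hD J hJ => ⟨?_, fun z hz => (hF J).2 ?_⟩, fun y => (hF _).unique ?_⟩
  · rintro _ ⟨I, hI, rfl⟩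
    exact (hF I).mono (hF J) (Set.image_mono (hJ.1 hI))
  · rintro _ ⟨y, hy, rfl⟩
    obtain ⟨I, hI, hyI⟩ := (mem_iff_of_isLUB_ideal hne hD hJ).1 hy
    exact ((hF I).1 ⟨y, hyI, rfl⟩).trans (hz ⟨I, hI, rfl⟩)
  · refine ⟨?_, fun z hz => hz ⟨y, Ideal.mem_principal.2 le_rfl, rfl⟩⟩
    rintro _ ⟨y', hy', rfl⟩
    exact hf (Ideal.mem_principal.1 hy')

theorem isInitialCompletion_principal [OrderBot Y] :
    IsInitialCompletion (Ideal.principal : Y → Ideal Y) where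
  isCompletion := isCompletion_principal
  initial X' _ _ i' hi' := by
    obtain ⟨F, hF, hFi⟩ := exists_extension_ideal hi'.complete hi'.monotone
    exact ⟨F, ⟨hF, hFi⟩, fun G hG =>
      isCompletion_principal.ext hG.1 hF fun y => (hG.2 y).trans (hFi y).symm⟩

/-- Monotone maps into complete posets extend to every initial completion, since an initial
completion maps to the ideal completion. -/
theorem IsInitialCompletion.exists_extension [OrderBot Y] {X : Type u} [PartialOrder X]
    [OrderBot X] {i : Y → X} (hi : IsInitialCompletion i) {Z : Type*} [PartialOrder Z]
    (hZ : IsCompletePoset Z) {f : Y → Z} (hf : Monotone f) :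
    ∃ F : X → Z, ScottContinuous F ∧ ∀ y, F (i y) = f y := by
  obtain ⟨h, ⟨hc, hp⟩, -⟩ := hi.initial (Ideal Y) Ideal.principal isCompletion_principal
  obtain ⟨F, hF, hFi⟩ := exists_extension_ideal hZ hf
  exact ⟨F ∘ h, hc.comp hF, fun y => by simp [hp, hFi]⟩

/-- The map of ideals induced by a monotone map `f` of several variables: the lower set generated
by the values of `f` on the tuples of elements of the given ideals. -/
def idealMap {J : Type*} {Y : J → Type*} {Z : Type*} [∀ j, PartialOrder (Y j)] [PartialOrder Z]
    (f : (∀ j, Y j) → Z) (hf : Monotone f) (I : ∀ j, Ideal (Y j)) : Ideal Z where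
  carrier := {z | ∃ v : ∀ j, Y j, (∀ j, v j ∈ I j) ∧ z ≤ f v}
  lower' := fun _ _ h ⟨v, hv, hz⟩ => ⟨v, hv, h.trans hz⟩
  nonempty' := by
    choose v hv using fun j => (I j).nonempty
    exact ⟨f v, v, hv, le_rfl⟩
  directed' := by
    rintro x ⟨v, hv, hx⟩ y ⟨w, hw, hy⟩
    choose z hz hvz hwz using fun j => (I j).directed (v j) (hv j) (w j) (hw j)
    exact ⟨f z, ⟨z, hz, le_rfl⟩, hx.trans (hf hvz), hy.trans (hf hwz)⟩

theorem idealMap_principal {J : Type*} {Y : J → Type*} {Z : Type*} [∀ j, PartialOrder (Y j)]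
    [PartialOrder Z] (f : (∀ j, Y j) → Z) (hf : Monotone f) (v : ∀ j, Y j) :
    idealMap f hf (fun j => Ideal.principal (v j)) = Ideal.principal (f v) := by
  refine le_antisymm ?_ (Ideal.principal_le_iff.2 ⟨v, fun j => Ideal.mem_principal.2 le_rfl, le_rfl⟩)
  rintro z ⟨w, hw, hz⟩
  exact Ideal.mem_principal.2 (hz.trans (hf fun j => Ideal.mem_principal.1 (hw j)))

theorem idealMap_mono {J : Type*} {Y : J → Type*} {Z : Type*} [∀ j, PartialOrder (Y j)]
    [PartialOrder Z] (f : (∀ j, Y j) → Z) (hf : Monotone f) : Monotone (idealMap f hf) :=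
  fun _ _ h _ ⟨v, hv, hz⟩ => ⟨v, fun j => h j (hv j), hz⟩

/-- The induced map of ideals is continuous when the number of variables is finite: finitely many
members of a directed union all lie in a single set of the union. -/
theorem scottContinuous_idealMap {J : Type*} [Finite J] {Y : J → Type*} {Z : Type*}
    [∀ j, PartialOrder (Y j)] [PartialOrder Z] (f : (∀ j, Y j) → Z) (hf : Monotone f) :
    ScottContinuous (idealMap f hf) := by
  intro D hne hdir I hI
  refine ⟨?_, fun L hL => ?_⟩
  · rintro _ ⟨I', hI', rfl⟩
    exact idealMap_mono f hf (hI.1 hI')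
  · rintro z ⟨v, hv, hz⟩
    have h (j : J) : ∃ I' ∈ D, v j ∈ I' j := by
      obtain ⟨_, ⟨I', hI', rfl⟩, hvj⟩ := (mem_iff_of_isLUB_ideal (hne.image _)
        (hdir.mono_comp (g := Function.eval j) (fun _ _ h => h j)) (isLUB_pi.1 hI j)).1 (hv j)
      exact ⟨I', hI', hvj⟩
    choose I' hI' hvI' using h
    obtain ⟨M, hM, hle⟩ : ∃ M ∈ D, ∀ j, I' j ≤ M := by
      have : Nonempty D := hne.to_subtype
      have : IsDirectedOrder D := directedOn_iff_isDirectedOrder.1 hdir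
      obtain ⟨M, hM⟩ := Finite.exists_le (fun j => (⟨I' j, hI' j⟩ : D))
      exact ⟨M.1, M.2, hM⟩
    exact hL ⟨M, hM, rfl⟩ ⟨v, fun j => hle j j (hvI' j), hz⟩

/-- An algebraic poset is the ideal completion of its compact elements, here identified with `Y`
through `e`; an element `x` corresponds to the ideal of compact elements below it. -/
noncomputable def IsAlgebraicPoset.orderIsoIdeal {V : Type u} [PartialOrder V]
    (hV : IsAlgebraicPoset V) (e : Compacts V ≃o Y) : V ≃o Ideal Y :=
  let toIdeal : V → Ideal Y := fun x =>
    { carrier := {y | (e.symm y).1 ≤ x}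
      lower' := fun _ _ h hy => le_trans (e.symm.monotone h) hy
      nonempty' := by
        obtain ⟨c, hc, hcx⟩ := (hV.2 x).1
        exact ⟨e ⟨c, hc⟩, by simpa using hcx⟩
      directed' := by
        intro y hy y' hy'
        obtain ⟨c, ⟨hc, hcx⟩, h, h'⟩ := (hV.2 x).2.1 _ ⟨(e.symm y).2, hy⟩ _ ⟨(e.symm y').2, hy'⟩
        exact ⟨e ⟨c, hc⟩, by simpa using hcx, e.symm_apply_le.1 h, e.symm_apply_le.1 h'⟩ }
  RelIso.ofSurjective
    (OrderEmbedding.ofMapLEIff toIdeal fun x x' => by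
      refine ⟨fun h => (hV.2 x).2.2.2 ?_, fun h y hy => le_trans hy h⟩
      rintro c ⟨hc, hcx⟩
      have : e ⟨c, hc⟩ ∈ toIdeal x := by
        change (e.symm (e ⟨c, hc⟩)).1 ≤ x
        simpa using hcx
      have h' : (e.symm (e ⟨c, hc⟩)).1 ≤ x' := h this
      simpa using h')
    (by
      intro I
      have hne : ((fun y => (e.symm y).1) '' (I : Set Y)).Nonempty := I.nonempty.image _
      have hdir : DirectedOn (· ≤ ·) ((fun y => (e.symm y).1) '' (I : Set Y)) :=
        I.directed.mono_comp (fun _ _ h => e.symm.monotone h)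
      obtain ⟨x, hx⟩ := hV.1 _ hne hdir
      refine ⟨x, le_antisymm (fun y hy => ?_) fun y hy => hx.1 ⟨y, hy, rfl⟩⟩
      obtain ⟨_, ⟨y', hy', rfl⟩, hle⟩ := (e.symm y).2 _ _ hne hdir hx hy
      exact I.lower (e.symm.le_iff_le.1 hle) hy')

theorem IsAlgebraicPoset.orderIsoIdeal_coe {V : Type u} [PartialOrder V]
    (hV : IsAlgebraicPoset V) (e : Compacts V ≃o Y) (c : Compacts V) :
    hV.orderIsoIdeal e c.1 = Ideal.principal (e c) := by
  ext y
  change (e.symm y).1 ≤ c.1 ↔ y ≤ e c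
  exact e.symm_apply_le

/-- Continuous maps on an algebraic poset are determined by their values on compact elements. -/
theorem IsAlgebraicPoset.ext {V : Type*} {Z : Type*} [PartialOrder V] [PartialOrder Z]
    (hV : IsAlgebraicPoset V) {f g : V → Z} (hf : ScottContinuous f) (hg : ScottContinuous g)
    (h : ∀ c : Compacts V, f c.1 = g c.1) : f = g := by
  funext x
  obtain ⟨hne, hdir, hx⟩ := hV.2 x
  have h1 := hf hne hdir hx
  rw [Set.image_congr (g := g) fun c hc => h ⟨c, hc.1⟩] at h1
  exact h1.unique (hg hne hdir hx)

end Ideals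

end DataAlg

namespace DataAlg

variable {Λ : Signature.{u}} {d : SimpleHeadType Λ}

/-! ### Head types -/

section Heads

open Classical in
/-- The head of an element: `⊥` for the least element and `♮` for every other one. -/
noncomputable def head {X : Type*} [PartialOrder X] [OrderBot X] (x : X) : Head :=
  if x = ⊥ then Head.bot else Head.nat

theorem head_eq_bot {X : Type*} [PartialOrder X] [OrderBot X] {x : X} :
    head x = Head.bot ↔ x = ⊥ := by
  unfold head
  split_ifs with h <;> simp [h]

theorem head_eq_of_iff {X Z : Type*} [PartialOrder X] [OrderBot X] [PartialOrder Z] [OrderBot Z]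
    {x : X} {z : Z} (h : x = ⊥ ↔ z = ⊥) : head x = head z := by
  by_cases hx : x = ⊥
  · rw [head_eq_bot.2 hx, head_eq_bot.2 (h.1 hx)]
  · rw [head, head, if_neg hx, if_neg fun hz => hx (h.2 hz)]

theorem OrderedAlgebra.isHeadAlgebra_iff {X : OrderedAlgebra Λ} :
    X.IsHeadAlgebra d ↔ ∀ {b : Λ.B} (k : Λ.K b) (v : Λ.Args X.carrier k),
      X.op k v = ⊥ ↔ d.op k (fun η => head (v η)) = Head.bot := by
  constructor
  · rintro ⟨π, hπ, hp⟩
    have hhead (b : Λ.B) (x : X.carrier b) : π b x = head x := by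
      by_cases hx : x = ⊥
      · rw [hx, head_eq_bot.2 rfl]
        exact hπ.map_bot b
      · have h1 : π b x ≠ Head.bot := hp b x hx
        have h2 : head x ≠ Head.bot := fun h => hx (head_eq_bot.1 h)
        generalize (π b x : Head) = s at *
        generalize head x = t at *
        cases s <;> cases t <;> first | rfl | contradiction
    intro b k v
    rw [← head_eq_bot, ← hhead]
    have h : π b (X.op k v) = d.op k (fun η => π _ (v η)) := hπ.map_op k v
    rw [h]
    simp only [hhead]
  · intro h
    refine ⟨fun b (x : X.carrier b) => head x,
      ⟨fun {b} k (x : Λ.Args X.carrier k) => ?_, fun b => ?_⟩,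
      fun b (x : X.carrier b) hx h => hx ((head_eq_bot (X := X.carrier b)).1 h)⟩
    · change head (X.op k x) = d.op k (fun η => head (x η))
      have h1 := head_eq_bot.trans (h k x)
      generalize head (X.op k x) = s at *
      generalize d.op k (fun η => head (x η)) = t at *
      cases s <;> cases t <;> simp_all
    · change head (⊥ : X.carrier b) = Head.bot
      exact head_eq_bot.2 rfl

/-- For a `♮`-stable head type, an operator that is non-bottom at some arguments in one algebra is
non-bottom in every algebra of that head type at arguments with at least as many non-bottom
entries. -/
theorem OrderedAlgebra.IsHeadAlgebra.op_ne_bot {X Z : OrderedAlgebra Λ} (hX : X.IsHeadAlgebra d)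
    (hZ : Z.IsHeadAlgebra d) (hd : d.toBottomed.IsStable) {b : Λ.B} {k : Λ.K b}
    {v : Λ.Args X.carrier k} {w : Λ.Args Z.carrier k} (hv : X.op k v ≠ ⊥)
    (h : ∀ η, v η ≠ ⊥ → w η ≠ ⊥) : Z.op k w ≠ ⊥ := by
  rw [Ne, isHeadAlgebra_iff.1 hX] at hv
  rw [Ne, isHeadAlgebra_iff.1 hZ]
  exact hd k _ _ hv fun η hη h' => h η (fun h0 => hη (head_eq_bot.2 h0)) (head_eq_bot.1 h')

/-- An initial completion of an algebra of a `♮`-stable head type has the same head type: an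
argument tuple `x` dominates a tuple of elements of `Y` with the same heads, and `p_k(x)` is a
least upper bound of values `q_k(v)`. -/
theorem OrderedAlgebra.IsInitialCompletionOf.isHeadAlgebra {X Y : OrderedAlgebra Λ}
    {i : ∀ b, Y.carrier b → X.carrier b} (hi : X.IsInitialCompletionOf Y i)
    (hY : Y.IsHeadAlgebra d) (hd : d.toBottomed.IsStable) : X.IsHeadAlgebra d := by
  have hc (b : Λ.B) : IsCompletion (i b) := (hi.isInitialCompletion b).isCompletion
  have hbot {b : Λ.B} {y : Y.carrier b} (h : i b y = ⊥) : y = ⊥ := by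
    rw [← le_bot_iff, ← (hc b).le_iff, h]
    exact bot_le
  have hY' {b : Λ.B} (k : Λ.K b) (v : Λ.Args Y.carrier k) := isHeadAlgebra_iff.1 hY k v
  refine isHeadAlgebra_iff.2 fun {b} k x => ⟨fun hx => ?_, fun hx => ?_⟩
  · have h (η : Λ.Arity k) : ∃ y, i _ y ≤ x η ∧ (y = ⊥ ↔ x η = ⊥) := by
      by_cases hη : x η = ⊥
      · exact ⟨⊥, by rw [(hc _).map_bot]; exact bot_le, by simp [hη]⟩
      · obtain ⟨y, hy, hle⟩ := (hc _).exists_ne_bot_le hη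
        exact ⟨y, hle, by simp [hy, hη]⟩
    choose y hyx hy using h
    have hle : i b (Y.op k y) ≤ X.op k x := by
      rw [← hi.op_extends]
      exact X.monotone_op k hyx
    have := (hY' k y).1 (hbot (le_bot_iff.1 (hx ▸ hle)))
    simpa only [head_eq_of_iff (hy _)] using this
  · obtain ⟨D, hne, hdir, hD⟩ := IsCompletion.exists_directed_pi (fun η => hc (Λ.dom k η)) x
    have hlub := hi.isContinuous.continuous_op k (hne.image _) (hdir.mono_comp (rb := (· ≤ ·))
      (g := fun (v : Λ.Args Y.carrier k) η => i _ (v η))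
      (fun _ _ h η => (hc _).monotone (h η))) hD
    refine le_bot_iff.1 (hlub.2 ?_)
    rintro _ ⟨_, ⟨v, hv, rfl⟩, rfl⟩
    change X.op k (fun η => i _ (v η)) ≤ ⊥
    rw [hi.op_extends, le_bot_iff]
    by_contra hne'
    have hv' : Y.op k v ≠ ⊥ := fun h => hne' (by rw [h, (hc b).map_bot])
    rw [Ne, hY'] at hv'
    refine hd k _ _ hv' (fun η hη h0 => hη (head_eq_bot.2 ?_)) hx
    have hle : i _ (v η) ≤ x η := hD.1 ⟨v, hv, rfl⟩ η
    exact hbot (le_bot_iff.1 ((head_eq_bot.1 h0) ▸ hle))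

end Heads

/-! ### Homomorphisms out of a minimal intrinsic algebra -/

section Hom

/-- The graph of the homomorphism `Y → Z` that extends the maps `f` given on the parameters. -/
inductive ExtensionGraph (Y Z : OrderedAlgebra Λ)
    (f : ∀ a : Λ.Param, Y.carrier a → Z.carrier a) :
    ∀ {b : Λ.B}, Y.carrier b → Z.carrier b → Prop
  | bot (b : Λ.B) : ExtensionGraph Y Z f (⊥ : Y.carrier b) ⊥
  | param {b : Λ.B} (hb : IsEmpty (Λ.K b)) (y : Y.carrier b) :
      ExtensionGraph Y Z f y (f ⟨b, hb⟩ y)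
  | op {b : Λ.B} (k : Λ.K b) (v : Λ.Args Y.carrier k) (w : Λ.Args Z.carrier k) :
      (∀ η, ExtensionGraph Y Z f (v η) (w η)) → ExtensionGraph Y Z f (Y.op k v) (Z.op k w)

variable {Y Z : OrderedAlgebra Λ} {f : ∀ a : Λ.Param, Y.carrier a → Z.carrier a}

theorem ExtensionGraph.eq_bot (hd : d.toBottomed.IsStable) (hY : Y.IsHeadAlgebra d)
    (hZ : Z.IsHeadAlgebra d) (hf : ∀ a, f a ⊥ = ⊥) {b : Λ.B} {y : Y.carrier b} {z : Z.carrier b}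
    (h : ExtensionGraph Y Z f y z) (hy : y = ⊥) : z = ⊥ := by
  induction h with
  | bot => rfl
  | param hb y => rw [hy, hf ⟨_, hb⟩]
  | op k v w _ ih =>
    by_contra hw
    exact hZ.op_ne_bot hY hd hw (fun η hη h0 => hη (ih η h0)) hy

/-- The extension graph is monotone, and in particular single-valued: in an intrinsic algebra,
`q_k(v) ⊑ q_k'(v')` with `q_k(v) ≠ ⊥` forces `k = k'` and `v ⊑ v'`. -/
theorem ExtensionGraph.le (hd : d.toBottomed.IsStable) (hY : Y.IsHeadAlgebra d)
    (hZ : Z.IsHeadAlgebra d) (hYi : Y.IsIntrinsic) (hf : ∀ a, f a ⊥ = ⊥)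
    (hfm : ∀ a, Monotone (f a)) {b : Λ.B} {y y' : Y.carrier b} {z z' : Z.carrier b}
    (h : ExtensionGraph Y Z f y z) (h' : ExtensionGraph Y Z f y' z') (hle : y ≤ y') : z ≤ z' := by
  by_cases hy : y = ⊥
  · rw [h.eq_bot hd hY hZ hf hy]
    exact bot_le
  induction h with
  | bot => exact absurd rfl hy
  | param hb y =>
    cases h' with
    | bot => exact absurd (le_bot_iff.1 hle) hy
    | param hb' y' => exact hfm _ hle
    | op k => exact (hb.false k).elim
  | @op b k v w hvw ih =>
    have hy' : y' ≠ ⊥ := fun h0 => hy (le_bot_iff.1 (h0 ▸ hle))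
    cases h' with
    | bot => exact absurd rfl hy'
    | param hb => exact (hb.false k).elim
    | op k' v' w' hvw' =>
      obtain ⟨l, v₁, v₂, h1, h2, hv⟩ := (hYi.le_iff b ⟨k⟩ _ _ hy hy').1 hle
      have e1 := (hYi.regular b ⟨k⟩ _ hy).unique (y₁ := ⟨k, v⟩) (y₂ := ⟨l, v₁⟩) rfl h1.symm
      have e2 := (hYi.regular b ⟨k⟩ _ hy').unique (y₁ := ⟨k', v'⟩) (y₂ := ⟨l, v₂⟩) rfl h2.symm
      cases e1
      cases e2
      refine Z.monotone_op _ fun η => ?_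
      by_cases hη : v η = ⊥
      · rw [(hvw η).eq_bot hd hY hZ hf hη]
        exact bot_le
      · exact ih η (hvw' η) (hv η) hη

/-- Bottomed monotone maps on the parameters of a minimal intrinsic `⋄`-algebra extend to a
homomorphism of ordered algebras into any `⋄`-algebra. -/
theorem exists_hom_of_minimal_intrinsic (hd : d.toBottomed.IsStable) (hY : Y.IsHeadAlgebra d)
    (hZ : Z.IsHeadAlgebra d) (hYi : Y.IsIntrinsic) (hYm : Y.toBottomed.IsMinimal)
    (hf : ∀ a, f a ⊥ = ⊥) (hfm : ∀ a, Monotone (f a)) :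
    ∃ π : ∀ b, Y.carrier b → Z.carrier b, (∀ b, Monotone (π b)) ∧ (∀ b, π b ⊥ = ⊥) ∧
      (∀ {b : Λ.B} (k : Λ.K b) (v : Λ.Args Y.carrier k),
        π b (Y.op k v) = Z.op k (fun η => π _ (v η))) ∧
      ∀ (a : Λ.Param) (y : Y.carrier a), π a y = f a y := by
  have htotal (b : Λ.B) (y : Y.carrier b) : ∃ z, ExtensionGraph Y Z f y z := by
    have := hYm (fun b => {y | ∃ z, ExtensionGraph Y Z f y z})
      (fun {b} k v hv => by
        choose w hw using hv
        exact ⟨_, .op k v w hw⟩)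
      (fun b => ⟨⊥, .bot b⟩)
      (fun a => Set.eq_univ_of_forall fun y => ⟨_, .param a.2 y⟩) b
    exact Set.eq_univ_iff_forall.1 this y
  choose π hπ using htotal
  have huniq {b : Λ.B} {y : Y.carrier b} {z : Z.carrier b} (h : ExtensionGraph Y Z f y z) :
      π b y = z :=
    le_antisymm ((hπ b y).le hd hY hZ hYi hf hfm h le_rfl)
      (h.le hd hY hZ hYi hf hfm (hπ b y) le_rfl)
  exact ⟨π, fun b y y' h => (hπ b y).le hd hY hZ hYi hf hfm (hπ b y') h,
    fun b => huniq (.bot b), fun k v => huniq (.op k v _ fun η => hπ _ (v η)),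
    fun a y => huniq (.param a.2 y)⟩

end Hom

/-! ### The ideal completion of an algebra -/

section Completion

open Order

/-- The ideal completion of an ordered algebra. -/
def idealAlgebra (Y : OrderedAlgebra Λ) : OrderedAlgebra Λ where
  carrier b := Ideal (Y.carrier b)
  op k := idealMap (Y.op k) (Y.monotone_op k)
  monotone_op k := idealMap_mono (Y.op k) (Y.monotone_op k)

theorem isInitialCompletionOf_idealAlgebra (Y : OrderedAlgebra Λ) :
    (idealAlgebra Y).IsInitialCompletionOf Y (fun _ => Ideal.principal) where
  isContinuous :=
    { complete := fun _ => isCompletePoset_ideal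
      continuous_op := fun k =>
        haveI := Λ.finite_arity k
        scottContinuous_idealMap _ (Y.monotone_op k) }
  isInitialCompletion _ := isInitialCompletion_principal
  op_extends k v := idealMap_principal _ (Y.monotone_op k) v

theorem exists_isInitialCompletionOver {V : Λ.Param → Type u} [∀ a, PartialOrder (V a)]
    (hV : ∀ a, IsAlgebraicPoset (V a)) (Y : OrderedAlgebra Λ)
    (ιY : Y.Binding (fun a => Compacts (V a))) :
    ∃ (X : OrderedAlgebra Λ) (ιX : X.Binding V) (i : ∀ b, Y.carrier b → X.carrier b),
      IsInitialCompletionOver V Y ιY X ιX i :=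
  ⟨idealAlgebra Y, fun a => (hV a).orderIsoIdeal (ιY a), fun _ => Ideal.principal,
    isInitialCompletionOf_idealAlgebra Y, fun a c => ((hV a).orderIsoIdeal_coe (ιY a) c).symm⟩

/-- Freeness of an initial completion: the homomorphism on `Y` extends to `X` by continuity, and
the extension commutes with the operators because it does so on tuples of elements of `Y`. -/
theorem isIntrinsicallyFree_of_isInitialCompletionOver (hd : d.toBottomed.IsStable)
    {V : Λ.Param → Type u} [∀ a, PartialOrder (V a)] [∀ a, OrderBot (V a)]
    (hV : ∀ a, IsAlgebraicPoset (V a)) {Y : OrderedAlgebra Λ}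
    {ιY : Y.Binding (fun a => Compacts (V a))} (hY : IsMinimalIntrinsicHeadAlgebra Y d ιY)
    {X : OrderedAlgebra Λ} {ιX : X.Binding V} {i : ∀ b, Y.carrier b → X.carrier b}
    (hX : IsInitialCompletionOver V Y ιY X ιX i) : IsIntrinsicallyFree d V X ιX := by
  intro Z hZc hZ τ hτ hτc
  have hi := hX.isInitialCompletionOf
  have hc (b : Λ.B) : IsCompletion (i b) := (hi.isInitialCompletion b).isCompletion
  -- The inclusion of `Y_a` in `V_a` as the compact elements, followed by `τ_a`.
  let f : ∀ a : Λ.Param, Y.carrier a → Z.carrier a := fun a y => τ a ((ιY a).symm y).1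
  have hf (a : Λ.Param) : f a ⊥ = ⊥ := by
    have hbot : IsCompactElement (⊥ : V a) := fun D _ ⟨x, hx⟩ _ _ _ => ⟨x, hx, bot_le⟩
    have hle : (ιY a).symm ⊥ ≤ ⟨⊥, hbot⟩ := (ιY a).symm_apply_le.2 bot_le
    have h0 : ((ιY a).symm ⊥).1 = ⊥ := le_bot_iff.1 hle
    simp only [f, h0, hτ]
  have hfm (a : Λ.Param) : Monotone (f a) :=
    fun y y' h => (hτc a).monotone ((ιY a).symm.monotone h)
  obtain ⟨ρ, hρm, hρb, hρo, hρf⟩ := exists_hom_of_minimal_intrinsic hd hY.isHeadAlgebra hZ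
    hY.intrinsic hY.minimal hf hfm
  choose π hπc hπ using fun b =>
    (hi.isInitialCompletion b).exists_extension (hZc.complete b) (hρm b)
  have hπop {b : Λ.B} (k : Λ.K b) :
      π b ∘ X.op k = fun x => Z.op k (fun η => π _ (x η)) := by
    refine IsCompletion.ext_pi (fun η => hc (Λ.dom k η))
      ((hi.isContinuous.continuous_op k).comp (hπc b))
      ((scottContinuous_pi_map fun η => hπc (Λ.dom k η)).comp (hZc.continuous_op k)) fun v => ?_
    simp only [Function.comp, hi.op_extends, hπ, hρo]
  refine ⟨π, ⟨⟨⟨fun k x => congrFun (hπop k) x, fun b => ?_⟩, fun b => (hπc b).monotone, hπc⟩,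
    fun a x => ?_⟩, ?_⟩
  · change π b ⊥ = ⊥
    rw [← (hc b).map_bot, hπ, hρb]
  · refine congrFun ((hV a).ext ((scottContinuous_orderIso (ιX a)).comp (hπc a)) (hτc a)
      fun c => ?_) x
    simp only [Function.comp]
    rw [← hX.compatible, hπ, hρf]
    simp [f]
  · rintro π' ⟨hπ', hπ'τ⟩
    funext b
    refine (hc b).ext (hπ'.continuous b) (hπc b) fun y => ?_
    -- The set on which the two homomorphisms agree is everything, by minimality.
    have := hY.minimal (fun b => {y | π' b (i b y) = π b (i b y)})
      (fun {b} k (v : Λ.Args Y.carrier k) hv => by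
        change π' b (i b (Y.op k v)) = π b (i b (Y.op k v))
        rw [← hi.op_extends]
        refine (hπ'.isBottomedHom.map_op k _).trans (Eq.trans ?_ (congrFun (hπop k) _).symm)
        exact congrArg (Z.op k) (funext hv))
      (fun b => by
        change π' b (i b ⊥) = π b (i b ⊥)
        rw [hπ, hρb, (hc b).map_bot]
        exact hπ'.isBottomedHom.map_bot b)
      (fun a => Set.eq_univ_of_forall fun (y : Y.carrier a) => by
        change π' a (i a y) = π a (i a y)
        rw [hπ, hρf]
        obtain ⟨c, rfl⟩ := (ιY a).surjective y
        rw [hX.compatible, hπ'τ]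
        simp [f]) b
    exact Set.eq_univ_iff_forall.1 this y

end Completion

/-! ### Existence of a minimal intrinsic algebra -/

/-- Formal terms over the signature, with a formal bottom of each type and the non-bottom elements
of the posets `U_a` as generators. -/
inductive FormalTerm (U : Λ.Param → Type u) [∀ a, PartialOrder (U a)] [∀ a, OrderBot (U a)] :
    Λ.B → Type u
  | bot (b : Λ.B) : FormalTerm U b
  | param {b : Λ.B} (hb : IsEmpty (Λ.K b)) (u : U ⟨b, hb⟩) (hu : u ≠ ⊥) : FormalTerm U b
  | op {b : Λ.B} (k : Λ.K b) (v : ∀ η, FormalTerm U (Λ.dom k η)) : FormalTerm U b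

namespace FormalTerm

variable {U : Λ.Param → Type u} [∀ a, PartialOrder (U a)] [∀ a, OrderBot (U a)]

/-- The head of a formal term, regarding every term other than a formal bottom as non-bottom. -/
def termHead {b : Λ.B} : FormalTerm U b → Head
  | bot _ => Head.bot
  | param _ _ _ => Head.nat
  | op _ _ => Head.nat

/-- A formal term is reduced if no operator in it takes the value `⊥` according to the head
type. -/
def IsReduced (d : SimpleHeadType Λ) : ∀ {b : Λ.B}, FormalTerm U b → Prop
  | _, bot _ => True
  | _, param _ _ _ => True
  | _, op k v => (∀ η, IsReduced d (v η)) ∧ d.op k (fun η => termHead (v η)) ≠ Head.bot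

/-- The order of formal terms: formal bottoms are least, generators are ordered as in `U`, and
terms with the same outermost operator are compared argument by argument. -/
protected inductive Le : ∀ {b : Λ.B}, FormalTerm U b → FormalTerm U b → Prop
  | bot {b : Λ.B} (t : FormalTerm U b) : FormalTerm.Le (bot b) t
  | param {b : Λ.B} (hb : IsEmpty (Λ.K b)) {u u' : U ⟨b, hb⟩} (hu : u ≠ ⊥) (hu' : u' ≠ ⊥) :
      u ≤ u' → FormalTerm.Le (param hb u hu) (param hb u' hu')
  | op {b : Λ.B} (k : Λ.K b) {v v' : ∀ η, FormalTerm U (Λ.dom k η)} :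
      (∀ η, FormalTerm.Le (v η) (v' η)) → FormalTerm.Le (op k v) (op k v')

instance (b : Λ.B) : PartialOrder (FormalTerm U b) where
  le := FormalTerm.Le
  le_refl t := by
    induction t with
    | bot => exact .bot _
    | param hb u hu => exact .param hb hu hu le_rfl
    | op k v ih => exact .op k ih
  le_trans s t r hst htr := by
    induction hst with
    | bot => exact .bot _
    | param hb hu hu' h => cases htr with
      | param _ _ hu'' h' => exact .param hb hu hu'' (h.trans h')
    | op k h ih => cases htr with
      | op _ h' => exact .op k fun η => ih η _ (h' η)
  le_antisymm s t hst hts := by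
    induction hst with
    | bot => cases hts; rfl
    | param hb hu hu' h => cases hts with
      | param _ _ _ h' => cases le_antisymm h h'; rfl
    | op k h ih => cases hts with
      | op _ h' => rw [funext fun η => ih η (h' η)]

instance (b : Λ.B) : OrderBot (FormalTerm U b) where
  bot := bot b
  bot_le t := .bot t

theorem termHead_eq_bot {b : Λ.B} {t : FormalTerm U b} : termHead t = Head.bot ↔ t = bot b := by
  cases t <;> simp [termHead]

theorem op_le_op {b : Λ.B} {k : Λ.K b} {v v' : ∀ η, FormalTerm U (Λ.dom k η)} :
    op k v ≤ op k v' ↔ ∀ η, v η ≤ v' η :=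
  ⟨fun h => by cases h with | op _ h => exact h, fun h => .op k h⟩

/-- Reduced terms. -/
abbrev Reduced (d : SimpleHeadType Λ) (U : Λ.Param → Type u) [∀ a, PartialOrder (U a)]
    [∀ a, OrderBot (U a)] (b : Λ.B) : Type u :=
  {t : FormalTerm U b // IsReduced d t}

instance (b : Λ.B) : OrderBot (Reduced d U b) :=
  Subtype.orderBot (show IsReduced d (bot b) from trivial)

theorem coe_eq_bot {b : Λ.B} {t : Reduced d U b} : t.1 = bot b ↔ t = ⊥ :=
  (Subtype.ext_iff (a1 := t) (a2 := ⊥)).symm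

open Classical in
/-- The operators on reduced terms: formal application where the head type prescribes a non-bottom
value, and the formal bottom elsewhere. -/
noncomputable def reducedOp {b : Λ.B} (k : Λ.K b) (v : ∀ η, Reduced d U (Λ.dom k η)) :
    Reduced d U b :=
  if h : d.op k (fun η => termHead (v η).1) = Head.bot then ⊥
  else ⟨op k fun η => (v η).1, fun η => (v η).2, h⟩

theorem reducedOp_eq_bot {b : Λ.B} {k : Λ.K b} {v : ∀ η, Reduced d U (Λ.dom k η)} :
    reducedOp k v = ⊥ ↔ d.op k (fun η => termHead (v η).1) = Head.bot := by
  unfold reducedOp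
  split_ifs with h
  · simp [h]
  · simp only [h, iff_false, ← coe_eq_bot]
    exact nofun

theorem coe_reducedOp {b : Λ.B} {k : Λ.K b} {v : ∀ η, Reduced d U (Λ.dom k η)}
    (h : reducedOp k v ≠ ⊥) : (reducedOp k v).1 = op k fun η => (v η).1 := by
  rw [Ne, reducedOp_eq_bot] at h
  simp [reducedOp, h]

theorem exists_reducedOp_eq {b : Λ.B} (hb : Nonempty (Λ.K b)) {t : Reduced d U b} (ht : t ≠ ⊥) :
    ∃ (k : Λ.K b) (v : ∀ η, Reduced d U (Λ.dom k η)), reducedOp k v = t := by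
  obtain ⟨t, hr⟩ := t
  cases t with
  | bot => exact absurd rfl ht
  | param hb' => exact (hb'.false hb.some).elim
  | op k v =>
    refine ⟨k, fun η => ⟨v η, hr.1 η⟩, ?_⟩
    simp [reducedOp, hr.2]

theorem reducedOp_monotone (hd : d.toBottomed.IsStable) {b : Λ.B} (k : Λ.K b) :
    Monotone (reducedOp k : (∀ η, Reduced d U (Λ.dom k η)) → Reduced d U b) := by
  intro v v' h
  by_cases hv : reducedOp k v = ⊥
  · rw [hv]
    exact bot_le
  have hv' : reducedOp k v' ≠ ⊥ := by
    rw [reducedOp_eq_bot] at hv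
    rw [Ne, reducedOp_eq_bot]
    refine hd k _ _ hv fun η hη h0 => hη (termHead_eq_bot.2 ?_)
    have hle : (v η).1 ≤ (v' η).1 := h η
    exact le_bot_iff.1 (hle.trans_eq (termHead_eq_bot.1 h0))
  rw [← Subtype.coe_le_coe, coe_reducedOp hv, coe_reducedOp hv']
  exact op_le_op.2 h

/-- The algebra of reduced terms. -/
noncomputable def reducedAlgebra (hd : d.toBottomed.IsStable) (U : Λ.Param → Type u)
    [∀ a, PartialOrder (U a)] [∀ a, OrderBot (U a)] : OrderedAlgebra Λ where
  carrier := Reduced d U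
  op k := reducedOp k
  monotone_op k := reducedOp_monotone hd k

open Classical in
/-- The elements of `U_a` as reduced terms. -/
noncomputable def ofParam (d : SimpleHeadType Λ) (a : Λ.Param) (u : U a) : Reduced d U a.1 :=
  if hu : u = ⊥ then ⊥ else ⟨param a.2 u hu, trivial⟩

theorem ofParam_le_iff {a : Λ.Param} {u u' : U a} : ofParam d a u ≤ ofParam d a u' ↔ u ≤ u' := by
  unfold ofParam
  split_ifs with h h' h'
  · simp [h]
  · simp [h]
  · simp only [h', le_bot_iff, h, iff_false, ← coe_eq_bot]
    exact nofun
  · exact ⟨fun hle => by cases hle with | param _ _ _ hle => exact hle,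
      fun hle => .param a.2 h h' hle⟩

theorem ofParam_surjective (a : Λ.Param) :
    Function.Surjective (ofParam d a : U a → Reduced d U a.1) := by
  rintro ⟨t, ht⟩
  obtain ⟨b, hb⟩ := a
  cases t with
  | bot => exact ⟨⊥, by simp [ofParam]; rfl⟩
  | param hb' u hu => exact ⟨u, by simp [ofParam, hu]⟩
  | op k => exact (hb.false k).elim

/-- The parameter posets of the algebra of reduced terms are the given ones. -/
noncomputable def reducedBinding (hd : d.toBottomed.IsStable) :
    (reducedAlgebra hd U).Binding U := fun a =>
  RelIso.ofSurjective (OrderEmbedding.ofMapLEIff (ofParam d a) fun _ _ => ofParam_le_iff)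
    (ofParam_surjective a)

theorem isMinimal_reducedAlgebra (hd : d.toBottomed.IsStable) :
    (reducedAlgebra hd U).toBottomed.IsMinimal := by
  intro S hS hbot hparam b
  refine Set.eq_univ_of_forall ?_
  rintro ⟨t, ht⟩
  induction t with
  | bot b => exact hbot b
  | @param b hb u hu =>
    rw [hparam ⟨b, hb⟩]
    trivial
  | @op b k v ih =>
    have h := hS k (fun η => ⟨v η, ht.1 η⟩) fun η => ih η (ht.1 η)
    have e : reducedOp k (fun η => (⟨v η, ht.1 η⟩ : Reduced d U _)) = ⟨op k v, ht⟩ := by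
      simp [reducedOp, ht.2]
    exact e ▸ h

theorem isIntrinsic_reducedAlgebra (hd : d.toBottomed.IsStable) :
    (reducedAlgebra hd U).IsIntrinsic where
  regular b hb x hx := by
    obtain ⟨k, v, rfl⟩ := exists_reducedOp_eq hb hx
    refine ⟨⟨k, v⟩, rfl, ?_⟩
    rintro ⟨k', v' : ∀ η, Reduced d U (Λ.dom k' η)⟩ (h : reducedOp k' v' = reducedOp k v)
    have hx' : reducedOp k v ≠ ⊥ := hx
    have e := congrArg Subtype.val h
    rw [coe_reducedOp hx', coe_reducedOp (h ▸ hx')] at e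
    injection e with _ hk hv
    subst hk
    congr 1
    funext η
    exact Subtype.ext (congrFun (eq_of_heq hv) η)
  le_iff b hb x₁ x₂ hx₁ hx₂ := by
    constructor
    · intro h
      obtain ⟨k, v, rfl⟩ := exists_reducedOp_eq hb hx₁
      obtain ⟨k', v', rfl⟩ := exists_reducedOp_eq hb hx₂
      have h' : (reducedOp k v).1 ≤ (reducedOp k' v').1 := h
      rw [coe_reducedOp hx₁, coe_reducedOp hx₂] at h'
      have hk : k = k' := by cases h'; rfl
      subst hk
      exact ⟨k, v, v', rfl, rfl, op_le_op.1 h'⟩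
    · rintro ⟨k, v₁, v₂, rfl, rfl, h⟩
      exact (reducedAlgebra hd U).monotone_op k h

theorem isHeadAlgebra_reducedAlgebra (hd : d.toBottomed.IsStable) :
    (reducedAlgebra hd U).IsHeadAlgebra d := by
  refine isHeadAlgebra_iff.2 fun {b} k v => reducedOp_eq_bot.trans ?_
  suffices h : ∀ η, termHead (v η).1 = head (v η) by simp only [h]
  intro η
  have h : termHead (v η).1 = Head.bot ↔ head (v η) = Head.bot :=
    (termHead_eq_bot.trans coe_eq_bot).trans head_eq_bot.symm
  generalize termHead (v η).1 = s at *
  generalize head (v η) = t at *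
  cases s <;> cases t <;> simp_all

end FormalTerm

end DataAlg

theorem proposition4p2p2 (Λ : Signature.{u}) (d : SimpleHeadType Λ)
    (hd : d.toBottomed.IsStable)
    (V : Λ.Param → Type u) [∀ a, PartialOrder (V a)] [∀ a, OrderBot (V a)]
    (hV : ∀ a, IsAlgebraicPoset (V a)) :
    (∃ (Y : OrderedAlgebra Λ) (ιY : Y.Binding (fun a => Compacts (V a))),
      IsMinimalIntrinsicHeadAlgebra Y d ιY) ∧
    ∀ (Y : OrderedAlgebra Λ) (ιY : Y.Binding (fun a => Compacts (V a))),
      IsMinimalIntrinsicHeadAlgebra Y d ιY →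
      (∃ (X : OrderedAlgebra Λ) (ιX : X.Binding V) (i : ∀ b, Y.carrier b → X.carrier b),
        IsInitialCompletionOver V Y ιY X ιX i) ∧
      ∀ (X : OrderedAlgebra Λ) (ιX : X.Binding V) (i : ∀ b, Y.carrier b → X.carrier b),
        IsInitialCompletionOver V Y ιY X ιX i →
        X.IsContinuous ∧ X.IsHeadAlgebra d ∧
        IsInitialBound d V X ιX ∧
        IsIntrinsicallyFree d V X ιX := by
  constructor
  -- The least element is compact, so the compact elements again form a poset with `⊥`.
  · let _ (a : Λ.Param) : OrderBot (Compacts (V a)) :=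
      Subtype.orderBot fun D _ ⟨x, hx⟩ _ _ _ => ⟨x, hx, bot_le⟩
    exact ⟨FormalTerm.reducedAlgebra hd fun a => Compacts (V a), FormalTerm.reducedBinding hd,
      FormalTerm.isMinimal_reducedAlgebra hd, FormalTerm.isIntrinsic_reducedAlgebra hd,
      FormalTerm.isHeadAlgebra_reducedAlgebra hd⟩
  · refine fun Y ιY hY => ⟨exists_isInitialCompletionOver hV Y ιY, fun X ιX i hX => ?_⟩
    have hXc := hX.isInitialCompletionOf.isContinuous
    have hXd := hX.isInitialCompletionOf.isHeadAlgebra hY.isHeadAlgebra hd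
    have hfree := isIntrinsicallyFree_of_isInitialCompletionOver hd hV hY hX
    exact ⟨hXc, hXd, ⟨hXc, hXd, fun Z ι hZc hZ => hfree Z hZc hZ (fun a => ι a)
      (fun a => (ι a).map_bot) (fun a => scottContinuous_orderIso (ι a))⟩, hfree⟩
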